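/- Let $m,k\ge 0$ and $d_i\ge 0$ be integers, $x_b\in\mathbb R^m$, and for $i=1,\dots,k$ let $M_i\in\mathbb R^{m\times m}$, $\mu_i\in\mathbb R^m$, $H_i\in\mathbb R^{d_i\times m}$, $y_i\in\mathbb R^{d_i}$ be deterministic. Let $B,Q_i\in\mathbb R^{m\times m}$ be symmetric positive semidefinite and $R_i\in\mathbb R^{d_i\times d_i}$ symmetric positive definite. On a probability space, let $X_0^n\sim N(x_b,B)$, $V_i^n\sim N(0,Q_i)$, $W_i^n\sim N(0,R_i)$ ($n=1,2,\dots$; $i=1,\dots,k$) be random vectors that are all mutually independent. For $N\ge 2$ the EnKF ensemble of size $N$ is given, for $n=1,\dots,N$, by $X_{0|0}^n=X_0^n$ and, for $i=1,\dots,k$, $$X_{i|i-1}^n=M_iX_{i-1|i-1}^n+\mu_i+V_i^n,\qquad X_{i|i}^n=X_{i|i-1}^n+P_{i|i-1}^NH_i^{\mathrm T}\bigl(H_iP_{i|i-1}^NH_i^{\mathrm T}+R_i\bigr)^{-1}\bigl(y_i-W_i^n-H_iX_{i|i-1}^n\bigr),$$ where $P_{i|i-1}^N=\frac1{N-1}\sum_{n=1}^N(X_{i|i-1}^n-\bar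 X_{i|i-1}^N)(X_{i|i-1}^n-\bar X_{i|i-1}^N)^{\mathrm T}$ and $\bar X_{i|i-1}^N=\frac1N\sum_{n=1}^NX_{i|i-1}^n$ (the members depend on $N$). The reference ensemble is given by $U_{0|0}^n=X_0^n$ and, for $i=1,\dots,k$, $n\ge1$, $$U_{i|i-1}^n=M_iU_{i-1|i-1}^n+\mu_i+V_i^n,\qquad U_{i|i}^n=U_{i|i-1}^n+P_{i|i-1}H_i^{\mathrm T}\bigl(H_iP_{i|i-1}H_i^{\mathrm T}+R_i\bigr)^{-1}\bigl(y_i-W_i^n-H_iU_{i|i-1}^n\bigr),$$ where $P_{i|i-1}=E\bigl[(U_{i|i-1}^1-E(U_{i|i-1}^1))(U_{i|i-1}^1-E(U_{i|i-1}^1))^{\mathrm T}\bigr]$. Then for every $i=0,\dots,k$: 1. for every $N$, the random matrix $\begin{bmatrix}X_{i|i}^1,\dots,X_{i|i}^N\\ U_{i|i}^1,\dots,U_{i|i}^N\end{bmatrix}$ has exchangeable columns, i.e. its law is invariant under permutations of the columns; 2. $X_{i|i}^1\to U_{i|i}^1$ in $L^p$ as $N\to\infty$, for all $1\le p<\infty$;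 3. $\frac1N\sum_{n=1}^NX_{i|i}^n\to E(U_{i|i}^1)$ in $L^p$ as $N\to\infty$, for all $1\le p<\infty$; 4. if $i\ge1$, $P_{i|i-1}^N\to P_{i|i-1}$ in $L^p$ as $N\to\infty$, for all $1\le p<\infty$. Here $L^p$ convergence means that all the random elements involved lie in $L^p$ and that $E(|\cdot|^p)^{1/p}$ of the difference tends to $0$, with $|\cdot|$ the Euclidean norm for vectors and the spectral norm for matrices. -/

import Mathlib

open MeasureTheory ProbabilityTheory Filter Topology
open scoped ENNReal Matrix.Norms.L2Operator

noncomputable section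

namespace EnKF

/-- Random vectors `X 0, …, X (N-1)` are exchangeable if their joint law is invariant under
permutations of the indices. -/
def Exchangeable {Ω S : Type*} [MeasurableSpace Ω] [MeasurableSpace S] (μ : Measure Ω) {N : ℕ}
    (X : Fin N → Ω → S) : Prop :=
  ∀ (π : Equiv.Perm (Fin N)) (B : Set (Fin N → S)), MeasurableSet B →
    μ {ω | (fun n => X (π n) ω) ∈ B} = μ {ω | (fun n => X n ω) ∈ B}

/-- Convergence in `L^p`: all random elements belong to `L^p` and the `L^p` norm of the difference
tends to zero. On vectors the norm is the Euclidean one, on matrices the spectral norm. -/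
def ConvergesInLp {Ω F : Type*} [MeasurableSpace Ω] [NormedAddCommGroup F] (μ : Measure Ω)
    (p : ℝ≥0∞) (X : ℕ → Ω → F) (Y : Ω → F) : Prop :=
  (∀ N, MemLp (X N) p μ) ∧ MemLp Y p μ ∧
    Tendsto (fun N => eLpNorm (fun ω => X N ω - Y ω) p μ) atTop (𝓝 0)

/-- The sample mean `(1/N) ∑ xⁿ`. -/
def sampleMean {m N : ℕ} (x : Fin N → EuclideanSpace ℝ (Fin m)) : EuclideanSpace ℝ (Fin m) :=
  (N : ℝ)⁻¹ • ∑ n, x n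

/-- The sample covariance `1/(N-1) ∑ (xⁿ - x̄) (xⁿ - x̄)ᵀ`. -/
def sampleCov {m N : ℕ} (x : Fin N → EuclideanSpace ℝ (Fin m)) : Matrix (Fin m) (Fin m) ℝ :=
  ((N : ℝ) - 1)⁻¹ • ∑ n, Matrix.vecMulVec (WithLp.ofLp (x n - sampleMean x))
    (WithLp.ofLp (x n - sampleMean x))

/-- The covariance matrix `E[(X - E X) (X - E X)ᵀ]` of a random vector. -/
def covMatrix {Ω : Type*} [MeasurableSpace Ω] (μ : Measure Ω) {m : ℕ}
    (X : Ω → EuclideanSpace ℝ (Fin m)) : Matrix (Fin m) (Fin m) ℝ :=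
  Matrix.of fun a b => cov[fun ω => X ω a, fun ω => X ω b; μ]

/-- The data of a linear filtering problem with states in `ℝ^m` and, at time `i ≥ 1`, an
observation in `ℝ^(d i)`. The values of the time-indexed fields at `i = 0` are never used. -/
structure LinearModel (m : ℕ) (d : ℕ → ℕ) where
  /-- mean of the initial state -/
  xb : EuclideanSpace ℝ (Fin m)
  /-- covariance of the initial state -/
  B : Matrix (Fin m) (Fin m) ℝ
  /-- model operators -/
  M : ℕ → Matrix (Fin m) (Fin m) ℝ
  /-- deterministic model forcing -/
  drift : ℕ → EuclideanSpace ℝ (Fin m)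
  /-- model error covariances -/
  Q : ℕ → Matrix (Fin m) (Fin m) ℝ
  /-- observation operators -/
  H : (i : ℕ) → Matrix (Fin (d i)) (Fin m) ℝ
  /-- observation error covariances -/
  R : (i : ℕ) → Matrix (Fin (d i)) (Fin (d i)) ℝ
  /-- observed data -/
  y : (i : ℕ) → EuclideanSpace ℝ (Fin (d i))

/-- The simulated random vectors; the ensemble of size `N` uses the members `n < N`. -/
structure EnsembleNoise (m : ℕ) (d : ℕ → ℕ) (Ω : Type*) where
  /-- initial members -/
  X₀ : ℕ → Ω → EuclideanSpace ℝ (Fin m)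
  /-- model errors `V i n` -/
  V : ℕ → ℕ → Ω → EuclideanSpace ℝ (Fin m)
  /-- data perturbations `W i n` -/
  W : (i : ℕ) → ℕ → Ω → EuclideanSpace ℝ (Fin (d i))

/-- Labels of the random vectors used up to time `k`: the labels `model i n` and `data i n`,
`i < k`, stand for time `i + 1 ∈ {1, …, k}`. -/
inductive NoiseIndex (k : ℕ) : Type
  | init (n : ℕ) : NoiseIndex k
  | model (i : Fin k) (n : ℕ) : NoiseIndex k
  | data (i : Fin k) (n : ℕ) : NoiseIndex k

/-- The dimension of the random vector with a given label. -/
def NoiseIndex.dim (m : ℕ) (d : ℕ → ℕ) {k : ℕ} : NoiseIndex k → ℕ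
  | .init _ => m
  | .model _ _ => m
  | .data i _ => d (i + 1)

/-- All the random vectors used up to time `k`, as one family. -/
def EnsembleNoise.family {m : ℕ} {d : ℕ → ℕ} {Ω : Type*} (ξ : EnsembleNoise m d Ω) (k : ℕ) :
    (j : NoiseIndex k) → Ω → EuclideanSpace ℝ (Fin (j.dim m d))
  | .init n => ξ.X₀ n
  | .model i n => ξ.V (i + 1) n
  | .data i n => ξ.W (i + 1) n

namespace LinearModel

variable {m : ℕ} {d : ℕ → ℕ} (A : LinearModel m d)

/-- The gain `P Hᵀ (H P Hᵀ + R)⁻¹` at time `i` for a forecast covariance `P`. -/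
def gain (i : ℕ) (P : Matrix (Fin m) (Fin m) ℝ) : Matrix (Fin m) (Fin (d i)) ℝ :=
  P * (A.H i).transpose * (A.H i * P * (A.H i).transpose + A.R i)⁻¹

/-- Advance one member to time `i`: `M x + drift + v`. -/
def advance (i : ℕ) (x v : EuclideanSpace ℝ (Fin m)) : EuclideanSpace ℝ (Fin m) :=
  Matrix.toEuclideanLin (A.M i) x + A.drift i + v

/-- Update one member at time `i` with forecast covariance `P`:
`x + P Hᵀ (H P Hᵀ + R)⁻¹ (y - w - H x)`. -/
def update (i : ℕ) (P : Matrix (Fin m) (Fin m) ℝ) (x : EuclideanSpace ℝ (Fin m))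
    (w : EuclideanSpace ℝ (Fin (d i))) : EuclideanSpace ℝ (Fin m) :=
  x + Matrix.toEuclideanLin (A.gain i P) (A.y i - w - Matrix.toEuclideanLin (A.H i) x)

variable {Ω : Type*} (ξ : EnsembleNoise m d Ω)

/-- Members of the EnKF ensemble of size `N` after the analysis at time `i` (`X_{i|i}^n`). -/
def X (N : ℕ) : (i : ℕ) → Fin N → Ω → EuclideanSpace ℝ (Fin m)
  | 0 => fun n ω => ξ.X₀ n ω
  | i + 1 => fun n ω =>
      let Xf : Fin N → EuclideanSpace ℝ (Fin m) :=
        fun l => A.advance (i + 1) (X N i l ω) (ξ.V (i + 1) l ω)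
      A.update (i + 1) (sampleCov Xf) (Xf n) (ξ.W (i + 1) n ω)

/-- Members of the EnKF forecast ensemble of size `N` at time `i ≥ 1` (`X_{i|i-1}^n`). -/
def Xforecast (N i : ℕ) (n : Fin N) (ω : Ω) : EuclideanSpace ℝ (Fin m) :=
  A.advance i (A.X ξ N (i - 1) n ω) (ξ.V i n ω)

/-- The defining recursion of the EnKF, with the analysis written through the forecast ensemble. -/
theorem X_succ (N i : ℕ) (n : Fin N) (ω : Ω) :
    A.X ξ N (i + 1) n ω = A.update (i + 1) (sampleCov fun l => A.Xforecast ξ N (i + 1) l ω)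
      (A.Xforecast ξ N (i + 1) n ω) (ξ.W (i + 1) n ω) := rfl

variable [MeasurableSpace Ω] (μ : Measure Ω)

/-- Members of the reference ensemble after the analysis at time `i` (`U_{i|i}^n`): the same
random vectors are used, with the exact covariance of the forecast member in place of the sample
covariance. The first member has the label `0`. -/
def U : (i : ℕ) → ℕ → Ω → EuclideanSpace ℝ (Fin m)
  | 0 => fun n ω => ξ.X₀ n ω
  | i + 1 =>
      let Uf : ℕ → Ω → EuclideanSpace ℝ (Fin m) :=
        fun l ω => A.advance (i + 1) (U i l ω) (ξ.V (i + 1) l ω)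
      fun n ω => A.update (i + 1) (covMatrix μ (Uf 0)) (Uf n ω) (ξ.W (i + 1) n ω)

/-- Members of the reference forecast ensemble at time `i ≥ 1` (`U_{i|i-1}^n`). -/
def Uforecast (i n : ℕ) (ω : Ω) : EuclideanSpace ℝ (Fin m) :=
  A.advance i (A.U ξ μ (i - 1) n ω) (ξ.V i n ω)

/-- The defining recursion of the reference ensemble. -/
theorem U_succ (i n : ℕ) (ω : Ω) :
    A.U ξ μ (i + 1) n ω = A.update (i + 1) (covMatrix μ (A.Uforecast ξ μ (i + 1) 0))
      (A.Uforecast ξ μ (i + 1) n ω) (ξ.W (i + 1) n ω) := rfl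

end LinearModel

end EnKF

end

open MeasureTheory ProbabilityTheory Filter Topology
open scoped ENNReal Matrix.Norms.L2Operator

noncomputable section

namespace EnKF

/-! ### Convergence in all `L^p`: sums, Lipschitz maps, products, averages. -/

section LpConvergence

variable {Ω : Type*} [MeasurableSpace Ω] {μ : Measure Ω}
  {F G H : Type*} [NormedAddCommGroup F] [NormedAddCommGroup G] [NormedAddCommGroup H]

/-! The proof is an induction on time, comparing each ensemble member with the reference member
driven by the same noise. The reference members at a given time are i.i.d., whereas the ensemble
members are coupled through the sample covariance. That covariance is symmetric in the members, so
permuting the noise permutes the pairs (X, U). This gives exchangeability, and in particular all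
pairs have the same law.

Hence the `L^p` norm of the average of X - U is at most that of the first difference, and the `L^p`
law of large numbers handles the average of the U (`ConvergesInLp.mean`). Applied to members and to
their outer products, this yields convergence of the sample covariance
(`ConvergesInAllLp.sampleCov`).

The gain follows because the inverse of T + R is bounded uniformly over positive semidefinite T
(`exists_norm_inv_le`), which makes inversion Lipschitz where it is used (`ConvergesInAllLp.gain`).
The analysis step multiplies gain and innovation; Hölder's inequality costs a factor 2 in the
exponent, so the induction carries all finite p at once, and the Gaussian noise has all moments.

Ensemble sizes are written N + 1 so that member 0 always exists. At size 1 the sample covariance is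
0, which does not affect the limit. -/

/-- Convergence in `L^p` for all `1 ≤ p < ∞`. -/
def ConvergesInAllLp (μ : Measure Ω) (X : ℕ → Ω → F) (Y : Ω → F) : Prop :=
  ∀ p : ℝ≥0∞, 1 ≤ p → p ≠ ⊤ → ConvergesInLp μ p X Y

lemma ConvergesInAllLp.const {Y : Ω → F} (hY : ∀ p : ℝ≥0∞, p ≠ ⊤ → MemLp Y p μ) :
    ConvergesInAllLp μ (fun _ => Y) Y :=
  fun p _ hp => ⟨fun _ => hY p hp, hY p hp, by simp⟩

lemma ConvergesInAllLp.add {X X' : ℕ → Ω → F} {Y Y' : Ω → F} (h : ConvergesInAllLp μ X Y)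
    (h' : ConvergesInAllLp μ X' Y') :
    ConvergesInAllLp μ (fun N ω => X N ω + X' N ω) (fun ω => Y ω + Y' ω) := by
  intro p hp hp'
  obtain ⟨hX, hY, hT⟩ := h p hp hp'
  obtain ⟨hX', hY', hT'⟩ := h' p hp hp'
  refine ⟨fun N => (hX N).add (hX' N), hY.add hY', ?_⟩
  refine tendsto_of_tendsto_of_tendsto_of_le_of_le tendsto_const_nhds
    (by simpa using hT.add hT') (fun _ => zero_le) fun N => ?_
  calc eLpNorm (fun ω => X N ω + X' N ω - (Y ω + Y' ω)) p μ
      = eLpNorm ((fun ω => X N ω - Y ω) + (fun ω => X' N ω - Y' ω)) p μ := by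
        congr 1; ext ω; simp only [Pi.add_apply]; abel
    _ ≤ _ := eLpNorm_add_le ((hX N).sub hY).1 ((hX' N).sub hY').1 hp

/-- A sequence that is dominated through a Lipschitz bound converges in all `L^p`. -/
lemma ConvergesInAllLp.of_norm_sub_le [IsFiniteMeasure μ] {X : ℕ → Ω → F} {y : F}
    {X' : ℕ → Ω → G} {y' : G} (h : ConvergesInAllLp μ X (fun _ => y)) (C : ℝ)
    (hmeas : ∀ N, AEStronglyMeasurable (X' N) μ)
    (hC : ∀ N ω, ‖X' N ω - y'‖ ≤ C * ‖X N ω - y‖) :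
    ConvergesInAllLp μ X' (fun _ => y') := by
  intro p hp hp'
  obtain ⟨hX, hY, hT⟩ := h p hp hp'
  have hsub : ∀ N, MemLp (fun ω => X' N ω - y') p μ := fun N =>
    ((hX N).sub hY).of_le_mul ((hmeas N).sub aestronglyMeasurable_const)
      (Eventually.of_forall fun ω => hC N ω)
  refine ⟨fun N => ?_, memLp_const _, ?_⟩
  · simpa [Pi.add_def] using (hsub N).add (memLp_const y')
  · have : Tendsto (fun N => ENNReal.ofReal C * eLpNorm (fun ω => X N ω - y) p μ) atTop (𝓝 0) := by
      simpa using ENNReal.Tendsto.const_mul hT (Or.inr ENNReal.ofReal_ne_top)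
    refine tendsto_of_tendsto_of_tendsto_of_le_of_le tendsto_const_nhds this
      (fun _ => zero_le) fun N => ?_
    exact eLpNorm_le_mul_eLpNorm_of_ae_le_mul (Eventually.of_forall fun ω => hC N ω) p

variable [NormedSpace ℝ F] [NormedSpace ℝ G] [NormedSpace ℝ H]

lemma ConvergesInAllLp.linear [FiniteDimensional ℝ F] (L' : F →ₗ[ℝ] G) {X : ℕ → Ω → F} {Y : Ω → F}
    (h : ConvergesInAllLp μ X Y) :
    ConvergesInAllLp μ (fun N ω => L' (X N ω)) (fun ω => L' (Y ω)) := by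
  let L : F →L[ℝ] G := L'.toContinuousLinearMap
  change ConvergesInAllLp μ (fun N ω => L (X N ω)) (fun ω => L (Y ω))
  intro p hp hp'
  obtain ⟨hX, hY, hT⟩ := h p hp hp'
  refine ⟨fun N => L.comp_memLp' (hX N), L.comp_memLp' hY, ?_⟩
  have : Tendsto (fun N => ENNReal.ofReal ‖L‖ * eLpNorm (fun ω => X N ω - Y ω) p μ)
      atTop (𝓝 0) := by
    rw [← mul_zero (ENNReal.ofReal ‖L‖)]
    exact ENNReal.Tendsto.const_mul hT (Or.inr ENNReal.ofReal_ne_top)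
  refine tendsto_of_tendsto_of_tendsto_of_le_of_le tendsto_const_nhds this
    (fun _ => zero_le) fun N => ?_
  refine eLpNorm_le_mul_eLpNorm_of_ae_le_mul (Eventually.of_forall fun ω => ?_) p
  rw [← map_sub]
  exact L.le_opNorm _

lemma holderTriple_two_mul (p : ℝ≥0∞) : ENNReal.HolderTriple (2 * p) (2 * p) p := by
  constructor
  rw [ENNReal.mul_inv (by simp) (by simp), ← add_mul, ENNReal.inv_two_add_inv_two, one_mul]

lemma exists_nnnorm_le_of_bilin [FiniteDimensional ℝ F] [FiniteDimensional ℝ G]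
    (B : F →ₗ[ℝ] G →ₗ[ℝ] H) : ∃ C : NNReal, ∀ x y, ‖B x y‖₊ ≤ C * ‖x‖₊ * ‖y‖₊ :=
  ⟨‖B.toContinuousBilinearMap‖₊, fun x y => B.toContinuousBilinearMap.le_opNorm₂ x y⟩

lemma memLp_bilin [FiniteDimensional ℝ F] [FiniteDimensional ℝ G]
    (B : F →ₗ[ℝ] G →ₗ[ℝ] H) {f : Ω → F} {g : Ω → G} {p : ℝ≥0∞} (hf : MemLp f (2 * p) μ)
    (hg : MemLp g (2 * p) μ) : MemLp (fun ω => B (f ω) (g ω)) p μ := by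
  have hH := holderTriple_two_mul p
  obtain ⟨C, hC⟩ := exists_nnnorm_le_of_bilin B
  exact hf.of_bilin (fun x y => B x y) C hg
    (B.toContinuousBilinearMap.aestronglyMeasurable_comp₂ hf.1 hg.1)
    (Eventually.of_forall fun ω => hC _ _)

/-- With D = X - Y and D' = X' - Y', the difference is B(D, D') + B(D, Y') + B(Y, D'). Hölder with
exponents 2p, 2p bounds each term by a product with a factor tending to 0 and the other bounded. -/
lemma ConvergesInAllLp.bilin [FiniteDimensional ℝ F] [FiniteDimensional ℝ G]
    (B : F →ₗ[ℝ] G →ₗ[ℝ] H) {X : ℕ → Ω → F} {Y : Ω → F}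
    {X' : ℕ → Ω → G} {Y' : Ω → G}
    (h : ConvergesInAllLp μ X Y) (h' : ConvergesInAllLp μ X' Y') :
    ConvergesInAllLp μ (fun N ω => B (X N ω) (X' N ω)) (fun ω => B (Y ω) (Y' ω)) := by
  intro p hp hp'
  have hq : 1 ≤ 2 * p := hp.trans (le_mul_of_one_le_left zero_le (by norm_num))
  have hq' : 2 * p ≠ ⊤ := ENNReal.mul_ne_top (by simp) hp'
  have hH := holderTriple_two_mul p
  obtain ⟨hX, hY, hT⟩ := h _ hq hq'
  obtain ⟨hX', hY', hT'⟩ := h' _ hq hq'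
  obtain ⟨C, hB⟩ := exists_nnnorm_le_of_bilin B
  have hBm : ∀ {f : Ω → F} {g : Ω → G}, MemLp f (2 * p) μ → MemLp g (2 * p) μ →
      MemLp (fun ω => B (f ω) (g ω)) p μ := fun {f g} hf hg => memLp_bilin B hf hg
  have hBn : ∀ {f : Ω → F} {g : Ω → G}, MemLp f (2 * p) μ → MemLp g (2 * p) μ →
      eLpNorm (fun ω => B (f ω) (g ω)) p μ
        ≤ C * eLpNorm f (2 * p) μ * eLpNorm g (2 * p) μ := fun {f g} hf hg =>
    eLpNorm_le_eLpNorm_mul_eLpNorm_of_nnnorm hf.1 hg.1 (fun x y => B x y) C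
      (Eventually.of_forall fun ω => hB _ _)
  refine ⟨fun N => hBm (hX N) (hX' N), hBm hY hY', ?_⟩
  set a : ℕ → ℝ≥0∞ := fun N => eLpNorm (fun ω => X N ω - Y ω) (2 * p) μ with ha
  set b : ℕ → ℝ≥0∞ := fun N => eLpNorm (fun ω => X' N ω - Y' ω) (2 * p) μ with hb
  have hlim : Tendsto (fun N => C * a N * b N + (C * a N * eLpNorm Y' (2 * p) μ
      + C * eLpNorm Y (2 * p) μ * b N)) atTop (𝓝 0) := by
    have h1 : Tendsto (fun N => C * a N) atTop (𝓝 0) := by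
      simpa using ENNReal.Tendsto.const_mul hT (Or.inr (ENNReal.coe_ne_top (r := C)))
    have h2 : Tendsto (fun N => C * a N * b N) atTop (𝓝 0) := by
      simpa using ENNReal.Tendsto.mul h1 (Or.inr (by simp)) hT' (Or.inr (by simp))
    have h3 : Tendsto (fun N => C * a N * eLpNorm Y' (2 * p) μ) atTop (𝓝 0) := by
      simpa using ENNReal.Tendsto.mul_const h1 (Or.inr hY'.2.ne)
    have h4 : Tendsto (fun N => C * eLpNorm Y (2 * p) μ * b N) atTop (𝓝 0) := by
      simpa using ENNReal.Tendsto.const_mul hT'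
        (Or.inr (ENNReal.mul_ne_top (ENNReal.coe_ne_top (r := C)) hY.2.ne))
    simpa using h2.add (h3.add h4)
  refine tendsto_of_tendsto_of_tendsto_of_le_of_le tendsto_const_nhds hlim
    (fun _ => zero_le) fun N => ?_
  have e : (fun ω => B (X N ω) (X' N ω) - B (Y ω) (Y' ω))
      = (fun ω => B (X N ω - Y ω) (X' N ω - Y' ω))
        + ((fun ω => B (X N ω - Y ω) (Y' ω)) + (fun ω => B (Y ω) (X' N ω - Y' ω))) := by
    ext ω
    simp only [Pi.add_apply, map_sub, LinearMap.sub_apply]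
    abel
  have hd := (hX N).sub hY
  have hd' := (hX' N).sub hY'
  rw [e]
  refine (eLpNorm_add_le (hBm hd hd').1 ((hBm hd hY').1.add (hBm hY hd').1) hp).trans ?_
  refine add_le_add (hBn hd hd') ?_
  exact (eLpNorm_add_le (hBm hd hY').1 (hBm hY hd').1 hp).trans
    (add_le_add (hBn hd hY') (hBn hY hd'))

lemma ConvergesInAllLp.smul_const_seq [IsFiniteMeasure μ] [FiniteDimensional ℝ F] {c : ℕ → ℝ} {c₀ : ℝ}
    (hc : Tendsto c atTop (𝓝 c₀))
    {X : ℕ → Ω → F} {Y : Ω → F} (h : ConvergesInAllLp μ X Y) :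
    ConvergesInAllLp μ (fun N ω => c N • X N ω) (fun ω => c₀ • Y ω) := by
  -- The scalars are treated as deterministic random variables, so that the product rule applies.
  have hc' : ConvergesInAllLp μ (fun N (_ : Ω) => c N) (fun _ => c₀) := by
    intro p hp hp'
    refine ⟨fun N => memLp_const _, memLp_const _, ?_⟩
    have hp0 : p ≠ 0 := (zero_lt_one.trans_le hp).ne'
    simp only [eLpNorm_const' _ hp0 hp']
    have h1 : Tendsto (fun N => ‖c N - c₀‖ₑ) atTop (𝓝 0) := by
      have : Tendsto (fun N => c N - c₀) atTop (𝓝 0) := by simpa using hc.sub_const c₀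
      simpa using this.enorm
    have h2 := ENNReal.Tendsto.mul_const (b := μ Set.univ ^ (1 / p.toReal)) h1
      (Or.inr (ENNReal.rpow_ne_top_of_nonneg (by positivity) (measure_ne_top μ _)))
    simpa using h2
  exact hc'.bilin (LinearMap.lsmul ℝ F) h

/-- Law of large numbers in `L^p` along a triangular array that is asymptotically close to an
i.i.d. sequence. -/
lemma ConvergesInLp.mean [CompleteSpace F] [MeasurableSpace F] [BorelSpace F]
    [SecondCountableTopology F] [IsProbabilityMeasure μ]
    {p : ℝ≥0∞} (hp : 1 ≤ p) (hp' : p ≠ ⊤) {Z : (N : ℕ) → Fin (N + 1) → Ω → F} {W : ℕ → Ω → F}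
    (h : ConvergesInLp μ p (fun N => Z N 0) (W 0))
    (hid : ∀ N (n : Fin (N + 1)),
      IdentDistrib (fun ω => (Z N n ω, W n ω)) (fun ω => (Z N 0 ω, W 0 ω)) μ μ)
    (hind : Pairwise fun i j => IndepFun (W i) (W j) μ) :
    ConvergesInLp μ p (fun N ω => ((N + 1 : ℕ) : ℝ)⁻¹ • ∑ n, Z N n ω) (fun _ => ∫ ω, W 0 ω ∂μ) := by
  obtain ⟨hX, hY, hT⟩ := h
  have hidZ : ∀ N (n : Fin (N + 1)), IdentDistrib (Z N n) (Z N 0) μ μ :=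
    fun N n => (hid N n).comp measurable_fst
  -- Row N = n of the array is the first one that contains the index n, as its last.
  have hidW : ∀ n, IdentDistrib (W n) (W 0) μ μ :=
    fun n => by simpa using! (hid n (Fin.last n)).comp measurable_snd
  have hidD : ∀ N (n : Fin (N + 1)),
      IdentDistrib (fun ω => Z N n ω - W n ω) (fun ω => Z N 0 ω - W 0 ω) μ μ :=
    fun N n => (hid N n).comp (u := fun z : F × F => z.1 - z.2)
      (measurable_fst.sub measurable_snd)
  have hZm : ∀ N (n : Fin (N + 1)), MemLp (Z N n) p μ :=
    fun N n => (hidZ N n).symm.memLp_snd (hX N)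
  have hWm : ∀ n, MemLp (W n) p μ := fun n => (hidW n).symm.memLp_snd hY
  have hmZ : ∀ N, MemLp (fun ω => ((N + 1 : ℕ) : ℝ)⁻¹ • ∑ n, Z N n ω) p μ := fun N =>
    (memLp_finsetSum _ fun n _ => hZm N n).const_smul _
  refine ⟨hmZ, memLp_const _, ?_⟩
  have hlln := (strong_law_Lp hp hp' W hY hind hidW).comp (tendsto_add_atTop_nat 1)
  refine tendsto_of_tendsto_of_tendsto_of_le_of_le tendsto_const_nhds
    (by simpa using hT.add hlln) (fun _ => zero_le) fun N => ?_
  have hD : MemLp (fun ω => ((N + 1 : ℕ) : ℝ)⁻¹ • ∑ n : Fin (N + 1), (Z N n ω - W n ω)) p μ :=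
    (memLp_finsetSum _ fun n _ => (hZm N n).sub (hWm n)).const_smul _
  have hE : MemLp (fun ω => ((N + 1 : ℕ) : ℝ)⁻¹ • (∑ i ∈ Finset.range (N + 1), W i ω)
      - ∫ ω, W 0 ω ∂μ) p μ :=
    ((memLp_finsetSum _ fun n _ => hWm n).const_smul _).sub (memLp_const _)
  have e : (fun ω => ((N + 1 : ℕ) : ℝ)⁻¹ • ∑ n, Z N n ω - ∫ ω, W 0 ω ∂μ)
      = (fun ω => ((N + 1 : ℕ) : ℝ)⁻¹ • ∑ n : Fin (N + 1), (Z N n ω - W n ω))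
        + (fun ω => ((N + 1 : ℕ) : ℝ)⁻¹ • (∑ i ∈ Finset.range (N + 1), W i ω)
          - ∫ ω, W 0 ω ∂μ) := by
    ext ω
    simp only [Pi.add_apply, Finset.sum_range, Finset.sum_sub_distrib, smul_sub]
    abel
  rw [e]
  refine (eLpNorm_add_le hD.1 hE.1 hp).trans (add_le_add ?_ (by simp))
  calc eLpNorm (fun ω => ((N + 1 : ℕ) : ℝ)⁻¹ • ∑ n : Fin (N + 1), (Z N n ω - W n ω)) p μ
      = ‖((N + 1 : ℕ) : ℝ)⁻¹‖ₑ *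
          eLpNorm (∑ n : Fin (N + 1), fun ω => Z N n ω - W n ω) p μ := by
        rw [← eLpNorm_const_smul]
        congr 1
        ext ω
        simp
    _ ≤ ‖((N + 1 : ℕ) : ℝ)⁻¹‖ₑ *
          ∑ n : Fin (N + 1), eLpNorm (fun ω => Z N n ω - W n ω) p μ := by
        gcongr
        exact eLpNorm_sum_le (fun n _ => ((hZm N n).sub (hWm n)).1) hp
    -- All N + 1 differences have the same law, so the triangle inequality suffices; no independence
    -- of the Z is needed.
    _ = ‖((N + 1 : ℕ) : ℝ)⁻¹‖ₑ * ((N + 1 : ℕ) *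
          eLpNorm (fun ω => Z N 0 ω - W 0 ω) p μ) := by
        simp only [(hidD N _).eLpNorm_eq, Finset.sum_const, Finset.card_univ, Fintype.card_fin,
          nsmul_eq_mul]
    _ = eLpNorm (fun ω => Z N 0 ω - W 0 ω) p μ := by
        rw [← mul_assoc, enorm_inv (by positivity), Real.enorm_natCast,
          ENNReal.inv_mul_cancel (by simp) (by simp), one_mul]

end LpConvergence

/-! ### Matrix inverses and covariance matrices. -/

section MatrixLemmas

open Matrix

variable {m n : ℕ}

/-- The inverse is the adjugate times the scalar inverse of the determinant. With 0⁻¹ = 0 this is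
measurable on singular matrices too, where continuity may fail. -/
lemma stronglyMeasurable_matrix_inv {α : Type*} [MeasurableSpace α]
    {S : α → Matrix (Fin n) (Fin n) ℝ} (hS : StronglyMeasurable S) :
    StronglyMeasurable fun a => (S a)⁻¹ := by
  simp only [Matrix.inv_def, Ring.inverse_eq_inv']
  exact (continuous_id.matrix_det.comp_stronglyMeasurable hS).inv₀.smul
    (continuous_id.matrix_adjugate.comp_stronglyMeasurable hS)

lemma aestronglyMeasurable_matrix_inv {α : Type*} [MeasurableSpace α] {μ : Measure α}
    {S : α → Matrix (Fin n) (Fin n) ℝ} (hS : AEStronglyMeasurable S μ) :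
    AEStronglyMeasurable (fun a => (S a)⁻¹) μ :=
  ⟨fun a => (hS.mk S a)⁻¹, stronglyMeasurable_matrix_inv hS.stronglyMeasurable_mk,
    hS.ae_eq_mk.mono fun a ha => by simp only [ha]⟩

lemma l2_opNorm_le_of_forall (A : Matrix (Fin m) (Fin n) ℝ) {C : ℝ} (hC : 0 ≤ C)
    (h : ∀ x, ‖Matrix.toEuclideanLin A x‖ ≤ C * ‖x‖) : ‖A‖ ≤ C := by
  rw [Matrix.l2_opNorm_def]
  exact ContinuousLinearMap.opNorm_le_bound _ hC h

lemma norm_toEuclideanLin_le (A : Matrix (Fin m) (Fin n) ℝ) (x : EuclideanSpace ℝ (Fin n)) :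
    ‖Matrix.toEuclideanLin A x‖ ≤ ‖A‖ * ‖x‖ := by
  rw [Matrix.l2_opNorm_def]
  exact (((Matrix.toEuclideanLin (𝕜 := ℝ) (m := Fin m) (n := Fin n)).trans
    LinearMap.toContinuousLinearMap) A).le_opNorm x

/-- The inverses of `R + T`, with `T` positive semidefinite, are bounded uniformly in `T`. -/
lemma exists_norm_inv_le {R : Matrix (Fin n) (Fin n) ℝ} (hR : R.PosDef) :
    ∃ C : ℝ, 0 ≤ C ∧ ∀ T : Matrix (Fin n) (Fin n) ℝ, T.PosSemidef → ‖(T + R)⁻¹‖ ≤ C := by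
  obtain ⟨B, hB, hRB⟩ : ∃ B : Matrix (Fin n) (Fin n) ℝ, IsUnit B ∧ R = Bᴴ * B := by
    open scoped MatrixOrder in
    exact CStarAlgebra.isStrictlyPositive_iff_eq_star_mul_self.1 hR.isStrictlyPositive
  -- For x = (T + R)⁻¹ v, dropping T gives ‖B x‖² ≤ ⟨x, v⟩ ≤ ‖x‖ ‖v‖, while ‖x‖ ≤ ‖B⁻¹‖ ‖B x‖.
  -- Cancelling ‖x‖ leaves ‖x‖ ≤ ‖B⁻¹‖² ‖v‖.
  refine ⟨‖B⁻¹‖ ^ 2, by positivity, fun T hT => ?_⟩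
  have hS : (T + R).PosDef := hR.posSemidef_add hT
  refine l2_opNorm_le_of_forall _ (by positivity) fun v => ?_
  set x : EuclideanSpace ℝ (Fin n) := Matrix.toEuclideanLin (T + R)⁻¹ v with hx
  have act : ∀ (A : Matrix (Fin n) (Fin n) ℝ) (x : EuclideanSpace ℝ (Fin n)),
      Matrix.toEuclideanLin A x = WithLp.toLp 2 (A *ᵥ x.ofLp) := fun _ _ => rfl
  have hSx : Matrix.toEuclideanLin (T + R) x = v := by
    have hu : IsUnit (T + R).det := (Matrix.isUnit_iff_isUnit_det _).1 hS.isUnit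
    rw [hx, act, act, WithLp.ofLp_toLp, Matrix.mulVec_mulVec, Matrix.mul_nonsing_inv _ hu,
      Matrix.one_mulVec]
  have hBx : Matrix.toEuclideanLin B⁻¹ (Matrix.toEuclideanLin B x) = x := by
    have hu : IsUnit B.det := (Matrix.isUnit_iff_isUnit_det _).1 hB
    rw [act, act, WithLp.ofLp_toLp, Matrix.mulVec_mulVec, Matrix.nonsing_inv_mul _ hu,
      Matrix.one_mulVec]
  have h1 : ‖x‖ ≤ ‖B⁻¹‖ * ‖Matrix.toEuclideanLin B x‖ := by
    have := norm_toEuclideanLin_le B⁻¹ (Matrix.toEuclideanLin B x)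
    rwa [hBx] at this
  have h2 : ‖Matrix.toEuclideanLin B x‖ ^ 2 ≤ inner ℝ x v := by
    have hT' : 0 ≤ x.ofLp ⬝ᵥ (T *ᵥ x.ofLp) := by simpa using hT.dotProduct_mulVec_nonneg x.ofLp
    have e1 : inner ℝ x v = x.ofLp ⬝ᵥ (T *ᵥ x.ofLp) + x.ofLp ⬝ᵥ (R *ᵥ x.ofLp) := by
      rw [← hSx, act, EuclideanSpace.inner_eq_star_dotProduct, dotProduct_comm,
        WithLp.ofLp_toLp, Matrix.add_mulVec, dotProduct_add, star_trivial]
    have e2 : x.ofLp ⬝ᵥ (R *ᵥ x.ofLp) = ‖Matrix.toEuclideanLin B x‖ ^ 2 := by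
      rw [← real_inner_self_eq_norm_sq, act, EuclideanSpace.inner_eq_star_dotProduct, hRB,
        ← Matrix.mulVec_mulVec, Matrix.dotProduct_mulVec, WithLp.ofLp_toLp, star_trivial,
        Matrix.conjTranspose_eq_transpose_of_trivial, Matrix.vecMul_transpose]
    rw [e1, e2]
    linarith
  have h3 : inner ℝ x v ≤ ‖x‖ * ‖v‖ := real_inner_le_norm x v
  rcases (norm_nonneg x).eq_or_lt with h0 | h0
  · rw [← h0]; positivity
  · have h4 : ‖x‖ ^ 2 ≤ ‖B⁻¹‖ ^ 2 * (‖x‖ * ‖v‖) :=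
      calc ‖x‖ ^ 2 ≤ (‖B⁻¹‖ * ‖Matrix.toEuclideanLin B x‖) ^ 2 := by gcongr
        _ = ‖B⁻¹‖ ^ 2 * ‖Matrix.toEuclideanLin B x‖ ^ 2 := by ring
        _ ≤ _ := by gcongr; exact h2.trans h3
    refine le_of_mul_le_mul_left ?_ h0
    nlinarith

/-- Matrix multiplication as a bilinear map. -/
def mulBilin (l m n : ℕ) : Matrix (Fin l) (Fin m) ℝ →ₗ[ℝ] Matrix (Fin m) (Fin n) ℝ →ₗ[ℝ]
    Matrix (Fin l) (Fin n) ℝ :=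
  (LinearMap.mk₂ ℝ (fun A B => A * B) Matrix.add_mul (fun c A B => Matrix.smul_mul c A B)
    Matrix.mul_add (fun c A B => Matrix.mul_smul A c B))

/-- The action of matrices on Euclidean space as a bilinear map. -/
def actBilin (m n : ℕ) : Matrix (Fin m) (Fin n) ℝ →ₗ[ℝ] EuclideanSpace ℝ (Fin n) →ₗ[ℝ]
    EuclideanSpace ℝ (Fin m) :=
  (Matrix.toEuclideanLin (𝕜 := ℝ) (m := Fin m) (n := Fin n)).toLinearMap

/-- The outer product `x yᵀ` as a bilinear map. -/
def outerBilin (m : ℕ) : EuclideanSpace ℝ (Fin m) →ₗ[ℝ] EuclideanSpace ℝ (Fin m) →ₗ[ℝ]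
    Matrix (Fin m) (Fin m) ℝ :=
  (LinearMap.mk₂ ℝ (fun x y : EuclideanSpace ℝ (Fin m) =>
    Matrix.vecMulVec (WithLp.ofLp x) (WithLp.ofLp y))
    (fun x x' y => by simp [Matrix.add_vecMulVec]) (fun c x y => by simp [Matrix.smul_vecMulVec])
    (fun x y y' => by simp [Matrix.vecMulVec_add])
    (fun c x y => by simp [Matrix.vecMulVec_smul]))

@[simp] lemma outerBilin_apply (x y : EuclideanSpace ℝ (Fin m)) :
    outerBilin m x y = Matrix.vecMulVec (WithLp.ofLp x) (WithLp.ofLp y) := rfl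

lemma sampleCov_posSemidef {N : ℕ} (x : Fin (N + 1) → EuclideanSpace ℝ (Fin m)) :
    (sampleCov x).PosSemidef := by
  refine Matrix.PosSemidef.smul (Matrix.posSemidef_sum _ fun n _ => ?_) (by simp)
  simpa using Matrix.posSemidef_vecMulVec_self_star (WithLp.ofLp (x n - sampleMean x))

lemma sampleCov_comp_perm {N : ℕ} (π : Equiv.Perm (Fin N)) (x : Fin N → EuclideanSpace ℝ (Fin m)) :
    sampleCov (fun n => x (π n)) = sampleCov x := by
  have h : sampleMean (fun n => x (π n)) = sampleMean x := by
    simp only [sampleMean, Equiv.sum_comp π x]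
  simp only [sampleCov, h]
  rw [Equiv.sum_comp π fun n => Matrix.vecMulVec (WithLp.ofLp (x n - sampleMean x))
    (WithLp.ofLp (x n - sampleMean x))]

/-- The sample covariance through the sample second moment and the sample mean. -/
lemma sampleCov_eq {N : ℕ} (x : Fin (N + 1) → EuclideanSpace ℝ (Fin m)) :
    sampleCov x = (((N + 1 : ℕ) : ℝ) / N) • (((N + 1 : ℕ) : ℝ)⁻¹ • ∑ n, outerBilin m (x n) (x n)
      - outerBilin m (sampleMean x) (sampleMean x)) := by
  have hN : ((N + 1 : ℕ) : ℝ) ≠ 0 := by positivity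
  have hs : ∑ n, x n = ((N + 1 : ℕ) : ℝ) • sampleMean x := by
    rw [sampleMean, smul_smul, mul_inv_cancel₀ hN, one_smul]
  have h : ∑ n, outerBilin m (x n - sampleMean x) (x n - sampleMean x)
      = ∑ n, outerBilin m (x n) (x n)
        - ((N + 1 : ℕ) : ℝ) • outerBilin m (sampleMean x) (sampleMean x) := by
    have h1 : ∑ n, outerBilin m (x n) (sampleMean x)
        = ((N + 1 : ℕ) : ℝ) • outerBilin m (sampleMean x) (sampleMean x) := by
      rw [← LinearMap.sum_apply, ← map_sum, hs, map_smul, LinearMap.smul_apply]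
    have h2 : ∑ n, outerBilin m (sampleMean x) (x n)
        = ((N + 1 : ℕ) : ℝ) • outerBilin m (sampleMean x) (sampleMean x) := by
      rw [← map_sum, hs, map_smul]
    simp only [map_sub, LinearMap.sub_apply, Finset.sum_sub_distrib, h1, h2,
      Finset.sum_const, Finset.card_univ, Fintype.card_fin, ← Nat.cast_smul_eq_nsmul ℝ]
    abel
  have h' : sampleCov x = ((N : ℝ))⁻¹ •
      ∑ n, outerBilin m (x n - sampleMean x) (x n - sampleMean x) := by
    simp only [sampleCov, Nat.cast_add_one, add_sub_cancel_right]
    rfl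
  -- The case N = 0 needs no separate treatment: both sides carry the factor N⁻¹, which is then 0.
  rw [h', h, div_eq_mul_inv, mul_comm, ← smul_smul, smul_sub (((N + 1 : ℕ) : ℝ)),
    smul_smul (((N + 1 : ℕ) : ℝ)), mul_inv_cancel₀ hN, one_smul]

variable {Ω : Type*} [MeasurableSpace Ω] {μ : Measure Ω}

lemma covMatrix_eq [IsProbabilityMeasure μ] {X : Ω → EuclideanSpace ℝ (Fin m)}
    (hX : MemLp X 2 μ) :
    covMatrix μ X = ∫ ω, outerBilin m (X ω) (X ω) ∂μ
      - outerBilin m (∫ ω, X ω ∂μ) (∫ ω, X ω ∂μ) := by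
  have hc : ∀ a, MemLp (fun ω => X ω a) 2 μ := fun a =>
    (EuclideanSpace.proj (𝕜 := ℝ) a).comp_memLp' hX
  have hi : Integrable (fun ω => outerBilin m (X ω) (X ω)) μ := by
    have := memLp_bilin (p := 1) (outerBilin m) (f := X) (g := X) (by simpa) (by simpa)
    exact memLp_one_iff_integrable.1 this
  have hE : ∀ a, (∫ ω, X ω ∂μ) a = ∫ ω, X ω a ∂μ := fun a =>
    ((EuclideanSpace.proj (𝕜 := ℝ) a).integral_comp_comm (hX.integrable (by norm_num))).symm
  ext a b
  -- Reading off an entry is a continuous linear functional, so it commutes with the integral.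
  let L : Matrix (Fin m) (Fin m) ℝ →L[ℝ] ℝ :=
    (Matrix.entryLinearMap ℝ ℝ a b).toContinuousLinearMap
  have hL : L (∫ ω, outerBilin m (X ω) (X ω) ∂μ) = ∫ ω, X ω a * X ω b ∂μ :=
    (L.integral_comp_comm hi).symm
  change (∫ ω, outerBilin m (X ω) (X ω) ∂μ) a b = _ at hL
  rw [covMatrix, Matrix.of_apply, covariance_eq_sub (hc a) (hc b), Matrix.sub_apply, hL]
  simp [Matrix.vecMulVec_apply, hE]

/-- The quadratic form at x is the variance of the scalar variable ⟨x, X⟩. -/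
lemma covMatrix_posSemidef [IsFiniteMeasure μ] {X : Ω → EuclideanSpace ℝ (Fin m)}
    (hX : MemLp X 2 μ) : (covMatrix μ X).PosSemidef := by
  have hc : ∀ a, MemLp (fun ω => X ω a) 2 μ := fun a =>
    (EuclideanSpace.proj (𝕜 := ℝ) a).comp_memLp' hX
  refine Matrix.PosSemidef.of_dotProduct_mulVec_nonneg ?_ fun x => ?_
  · ext a b
    simp [covMatrix, covariance_comm]
  · have h : star x ⬝ᵥ (covMatrix μ X *ᵥ x)
        = cov[fun ω => ∑ a, x a * X ω a, fun ω => ∑ a, x a * X ω a; μ] := by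
      rw [covariance_fun_sum_fun_sum (fun a => (hc a).const_mul _) fun a => (hc a).const_mul _]
      simp only [covariance_const_mul_left, covariance_const_mul_right, dotProduct, mulVec,
        covMatrix, Matrix.of_apply, Finset.mul_sum, star_trivial]
      refine Finset.sum_congr rfl fun a _ => Finset.sum_congr rfl fun b _ => by ring
    rw [h, covariance_self (by
      exact (memLp_finsetSum _ fun a _ => (hc a).const_mul (x a)).1.aemeasurable)]
    exact variance_nonneg _ _

end MatrixLemmas

/-! ### The noise as a random path, relabelling and independence. -/

section Noise

variable {m : ℕ} {d : ℕ → ℕ} {k : ℕ} {Ω : Type*}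

/-- The member to which a random vector belongs. -/
def NoiseIndex.member : NoiseIndex k → ℕ
  | .init n => n
  | .model _ n => n
  | .data _ n => n

/-- Countability makes the whole path a.e. measurable as soon as each coordinate is. -/
instance : Countable (NoiseIndex k) := by
  let f : NoiseIndex k → ℕ ⊕ (Fin k × ℕ) ⊕ (Fin k × ℕ)
    | .init n => .inl n
    | .model i n => .inr (.inl (i, n))
    | .data i n => .inr (.inr (i, n))
  have hf : Function.Injective f := by
    rintro (a | ⟨i, a⟩ | ⟨i, a⟩) (b | ⟨j, b⟩ | ⟨j, b⟩) h <;> simp_all [f]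
  exact hf.countable

/-- Relabel the members. -/
def NoiseIndex.relabel (σ : ℕ → ℕ) : NoiseIndex k → NoiseIndex k
  | .init n => .init (σ n)
  | .model i n => .model i (σ n)
  | .data i n => .data i (σ n)

lemma NoiseIndex.relabel_injective {σ : ℕ → ℕ} (hσ : Function.Injective σ) :
    Function.Injective (NoiseIndex.relabel σ : NoiseIndex k → NoiseIndex k) := by
  rintro (a | ⟨i, a⟩ | ⟨i, a⟩) (b | ⟨j, b⟩ | ⟨j, b⟩) h <;>
    simp_all [NoiseIndex.relabel, hσ.eq_iff]

/-- The noise with relabelled members. -/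
def EnsembleNoise.relabel (ξ : EnsembleNoise m d Ω) (σ : ℕ → ℕ) : EnsembleNoise m d Ω where
  X₀ n := ξ.X₀ (σ n)
  V i n := ξ.V i (σ n)
  W i n := ξ.W i (σ n)

/-- All random vectors used up to time `k`, as one random element. -/
def EnsembleNoise.path (ξ : EnsembleNoise m d Ω) (k : ℕ) (ω : Ω) :
    (j : NoiseIndex k) → EuclideanSpace ℝ (Fin (j.dim m d)) :=
  fun j => ξ.family k j ω

variable (m d k) in
/-- The coordinate noise on the space of noise families. -/
def coordNoise : EnsembleNoise m d ((j : NoiseIndex k) → EuclideanSpace ℝ (Fin (j.dim m d))) where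
  X₀ n z := z (.init n)
  V
    -- Time 0 and times beyond k have no label; the value 0 is a filler, and `MemberAgree` requires
    -- nothing there.
    | 0, _, _ => 0
    | i + 1, n, z => if h : i < k then z (.model ⟨i, h⟩ n) else 0
  W
    | 0, _, _ => 0
    | i + 1, n, z => if h : i < k then z (.data ⟨i, h⟩ n) else 0

/-- Two realisations of the noise agree at all times `1 ≤ i ≤ k` for the members `n` and `n'`. -/
structure MemberAgree (k : ℕ) {Ω' : Type*} (ξ : EnsembleNoise m d Ω) (ξ' : EnsembleNoise m d Ω')
    (ω : Ω) (ω' : Ω') (n n' : ℕ) : Prop where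
  init : ξ.X₀ n ω = ξ'.X₀ n' ω'
  model : ∀ i < k, ξ.V (i + 1) n ω = ξ'.V (i + 1) n' ω'
  data : ∀ i < k, ξ.W (i + 1) n ω = ξ'.W (i + 1) n' ω'

/-- This reduces statements about laws on Ω to one recursion on path space, evaluated at relabelled
paths. -/
lemma memberAgree_relabel_path (ξ : EnsembleNoise m d Ω) (σ : ℕ → ℕ) (ω : Ω) (n : ℕ) :
    MemberAgree k ξ (coordNoise m d k) ω ((ξ.relabel σ).path k ω) (σ n) n where
  init := rfl
  model i hi := by simp [coordNoise, hi]; rfl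
  data i hi := by simp [coordNoise, hi]; rfl

lemma memberAgree_path (ξ : EnsembleNoise m d Ω) (ω : Ω) (n : ℕ) :
    MemberAgree k ξ (coordNoise m d k) ω (ξ.path k ω) n n :=
  memberAgree_relabel_path ξ id ω n

variable [MeasurableSpace Ω] {μ : Measure Ω}

/-- Independence and the laws are those of a family in which the law of a random vector does not
depend on the member it belongs to. -/
structure IIDNoise (μ : Measure Ω) (ξ : EnsembleNoise m d Ω) (k : ℕ) : Prop where
  aemeasurable : ∀ j, AEMeasurable (ξ.family k j) μ
  map_init : ∀ n n', μ.map (ξ.X₀ n) = μ.map (ξ.X₀ n')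
  map_model : ∀ i < k, ∀ n n', μ.map (ξ.V (i + 1) n) = μ.map (ξ.V (i + 1) n')
  map_data : ∀ i < k, ∀ n n', μ.map (ξ.W (i + 1) n) = μ.map (ξ.W (i + 1) n')
  indep : iIndepFun (ξ.family k) μ

namespace IIDNoise

variable {ξ : EnsembleNoise m d Ω}

lemma relabel (h : IIDNoise μ ξ k) {σ : ℕ → ℕ} (hσ : Function.Injective σ) :
    IIDNoise μ (ξ.relabel σ) k where
  aemeasurable
    | .init n => h.aemeasurable (.init (σ n))
    | .model i n => h.aemeasurable (.model i (σ n))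
    | .data i n => h.aemeasurable (.data i (σ n))
  map_init n n' := h.map_init _ _
  map_model i hi n n' := h.map_model i hi _ _
  map_data i hi n n' := h.map_data i hi _ _
  indep := by
    have h1 := (h.indep : iIndep _ μ).precomp (NoiseIndex.relabel_injective hσ)
    have h2 : (fun j : NoiseIndex k => MeasurableSpace.comap ((ξ.relabel σ).family k j)
        inferInstance) = (fun j => MeasurableSpace.comap (ξ.family k j) inferInstance) ∘
          NoiseIndex.relabel σ := by
      ext1 j
      cases j <;> rfl
    change iIndep _ μ
    rw [h2]
    exact h1

lemma aemeasurable_path (h : IIDNoise μ ξ k) : AEMeasurable (ξ.path k) μ :=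
  aemeasurable_pi_iff.2 h.aemeasurable

/-- Both path laws are products of their marginals, and the marginals do not depend on the member.
-/
lemma identDistrib_path (h : IIDNoise μ ξ k) {σ : ℕ → ℕ} (hσ : Function.Injective σ) :
    IdentDistrib ((ξ.relabel σ).path k) (ξ.path k) μ μ where
  aemeasurable_fst := (h.relabel hσ).aemeasurable_path
  aemeasurable_snd := h.aemeasurable_path
  map_eq := by
    have h1 := (h.relabel hσ).indep.map_fun_eq_infinitePi_map₀' (h.relabel hσ).aemeasurable
    have h2 := h.indep.map_fun_eq_infinitePi_map₀' h.aemeasurable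
    have h3 : (fun j => μ.map ((ξ.relabel σ).family k j)) = fun j => μ.map (ξ.family k j) := by
      ext1 j
      cases j with
      | init n => exact h.map_init _ _
      | model i n => exact h.map_model i i.2 _ _
      | data i n => exact h.map_data i i.2 _ _
    rw [h3] at h1
    exact h1.trans h2.symm

variable [IsProbabilityMeasure μ]

/-- Random elements that depend on the noise of different members only are independent. -/
lemma indepFun_of_member (h : IIDNoise μ ξ k) {S : Type*} [MeasurableSpace S]
    {f g : ((j : NoiseIndex k) → EuclideanSpace ℝ (Fin (j.dim m d))) → S} {a b : ℕ} (hab : a ≠ b)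
    (hf : Measurable[⨆ j ∈ {j : NoiseIndex k | j.member = a}, MeasurableSpace.comap
      (fun z : (j : NoiseIndex k) → EuclideanSpace ℝ (Fin (j.dim m d)) => z j) inferInstance] f)
    (hg : Measurable[⨆ j ∈ {j : NoiseIndex k | j.member = b}, MeasurableSpace.comap
      (fun z : (j : NoiseIndex k) → EuclideanSpace ℝ (Fin (j.dim m d)) => z j) inferInstance] g) :
    IndepFun (fun ω => f (ξ.path k ω)) (fun ω => g (ξ.path k ω)) μ := by
  -- The noise is only a.e. measurable on Ω. On path space the coordinates are measurable and
  -- independent, so the grouping of disjoint blocks is done there and pulled back.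
  have hlaw : μ.map (ξ.path k) = Measure.infinitePi fun j => μ.map (ξ.family k j) :=
    h.indep.map_fun_eq_infinitePi_map₀' h.aemeasurable
  have : ∀ j, IsProbabilityMeasure (μ.map (ξ.family k j)) := fun j =>
    Measure.isProbabilityMeasure_map (h.aemeasurable j)
  have hprob : IsProbabilityMeasure (μ.map (ξ.path k)) :=
    Measure.isProbabilityMeasure_map h.aemeasurable_path
  have hcoord : iIndepFun (fun (j : NoiseIndex k)
      (z : (j : NoiseIndex k) → EuclideanSpace ℝ (Fin (j.dim m d))) => z j)
      (μ.map (ξ.path k)) := by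
    rw [hlaw]
    exact iIndepFun_infinitePi (P := fun j => μ.map (ξ.family k j)) (X := fun _ x => x)
      fun j => measurable_id
  have hle : ∀ j : NoiseIndex k, MeasurableSpace.comap
      (fun z : (j : NoiseIndex k) → EuclideanSpace ℝ (Fin (j.dim m d)) => z j) inferInstance
        ≤ MeasurableSpace.pi := fun j => (measurable_pi_apply j).comap_le
  have hI := indep_iSup_of_disjoint hle (hcoord : iIndep _ _)
    (S := {j | j.member = a}) (T := {j | j.member = b})
    (Set.disjoint_left.2 fun j (hj : j.member = a) (hj' : j.member = b) => hab (hj.symm.trans hj'))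
  have hfg : IndepFun f g (μ.map (ξ.path k)) :=
    indep_of_indep_of_le_left (indep_of_indep_of_le_right hI hg.comap_le) hf.comap_le
  have hfm : Measurable f := hf.mono (iSup₂_le fun j _ => hle j) le_rfl
  have hgm : Measurable g := hg.mono (iSup₂_le fun j _ => hle j) le_rfl
  rw [indepFun_iff_measure_inter_preimage_eq_mul] at hfg ⊢
  intro s t hs ht
  have := hfg s t hs ht
  rw [Measure.map_apply_of_aemeasurable h.aemeasurable_path ((hfm hs).inter (hgm ht)),
    Measure.map_apply_of_aemeasurable h.aemeasurable_path (hfm hs),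
    Measure.map_apply_of_aemeasurable h.aemeasurable_path (hgm ht)] at this
  exact this

end IIDNoise

end Noise

/-! ### Equivariance, measurability and common laws of the two ensembles. -/

section Processes

variable {m : ℕ} {d : ℕ → ℕ} {k : ℕ} {Ω : Type*}

namespace LinearModel

variable (A : LinearModel m d)

/-- The reference ensemble driven by prescribed forecast covariances `P i`. -/
def Uwith (P : ℕ → Matrix (Fin m) (Fin m) ℝ) (ξ : EnsembleNoise m d Ω) :
    ℕ → ℕ → Ω → EuclideanSpace ℝ (Fin m)
  | 0 => fun n ω => ξ.X₀ n ω
  | i + 1 => fun n ω => A.update (i + 1) (P (i + 1))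
      (A.advance (i + 1) (Uwith P ξ i n ω) (ξ.V (i + 1) n ω)) (ξ.W (i + 1) n ω)

/-- `U` depends on μ through its covariances. Once these are frozen as matrices, the recursion is
pathwise and can be run on path space. -/
lemma U_eq_Uwith [MeasurableSpace Ω] (μ : Measure Ω) (ξ : EnsembleNoise m d Ω) (i n : ℕ) (ω : Ω) :
    A.U ξ μ i n ω = A.Uwith (fun i => covMatrix μ (A.Uforecast ξ μ i 0)) ξ i n ω := by
  induction i generalizing n with
  | zero => rfl
  | succ i ih =>
    simp only [U_succ, Uwith, ← ih]
    rfl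

section Congr

variable {Ω' : Type*} {ξ : EnsembleNoise m d Ω} {ξ' : EnsembleNoise m d Ω'} {ω : Ω} {ω' : Ω'}

lemma Uwith_congr (P : ℕ → Matrix (Fin m) (Fin m) ℝ) {n n' : ℕ}
    (h : MemberAgree k ξ ξ' ω ω' n n') {i : ℕ} (hi : i ≤ k) :
    A.Uwith P ξ i n ω = A.Uwith P ξ' i n' ω' := by
  induction i with
  | zero => exact h.init
  | succ i ih => simp only [Uwith, ih (by lia), h.model i hi, h.data i hi]

/-- Permuting the noise permutes the members, since their only coupling, the sample covariance, is
symmetric. -/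
lemma X_congr {N : ℕ} {π : Equiv.Perm (Fin N)}
    (h : ∀ n : Fin N, MemberAgree k ξ ξ' ω ω' (π n) n) {i : ℕ} (hi : i ≤ k) (n : Fin N) :
    A.X ξ N i (π n) ω = A.X ξ' N i n ω' := by
  induction i generalizing n with
  | zero => exact (h n).init
  | succ i ih =>
    have hf : ∀ n, A.Xforecast ξ N (i + 1) (π n) ω = A.Xforecast ξ' N (i + 1) n ω' := fun n => by
      rw [Xforecast, Xforecast, Nat.add_sub_cancel, ih (by lia), (h n).model i hi]
    rw [X_succ, X_succ, hf, (h n).data i hi,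
      ← sampleCov_comp_perm π (fun l => A.Xforecast ξ N (i + 1) l ω)]
    simp only [hf]

lemma Xforecast_congr {N : ℕ} {π : Equiv.Perm (Fin N)}
    (h : ∀ n : Fin N, MemberAgree k ξ ξ' ω ω' (π n) n) {i : ℕ} (hi : i < k) (n : Fin N) :
    A.Xforecast ξ N (i + 1) (π n) ω = A.Xforecast ξ' N (i + 1) n ω' := by
  rw [Xforecast, Xforecast, Nat.add_sub_cancel, A.X_congr h hi.le, (h n).model i hi]

end Congr

section Measurability

variable {α : Type*} [MeasurableSpace α]

lemma measurable_advance (i : ℕ) {x v : α → EuclideanSpace ℝ (Fin m)} (hx : Measurable x)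
    (hv : Measurable v) : Measurable fun a => A.advance i (x a) (v a) :=
  (((LinearMap.continuous_of_finiteDimensional (Matrix.toEuclideanLin (A.M i))).measurable.comp
    hx).add_const _).add hv

lemma stronglyMeasurable_bilin {F G H : Type*} [NormedAddCommGroup F] [NormedAddCommGroup G]
    [NormedAddCommGroup H] [NormedSpace ℝ F] [NormedSpace ℝ G] [NormedSpace ℝ H]
    [FiniteDimensional ℝ F] [FiniteDimensional ℝ G] (B : F →ₗ[ℝ] G →ₗ[ℝ] H) {f : α → F}
    {g : α → G} (hf : StronglyMeasurable f) (hg : StronglyMeasurable g) :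
    StronglyMeasurable fun a => B (f a) (g a) :=
  B.toContinuousBilinearMap.continuous₂.comp_stronglyMeasurable (hf.prodMk hg)

lemma stronglyMeasurable_gain (i : ℕ) {P : α → Matrix (Fin m) (Fin m) ℝ}
    (hP : StronglyMeasurable P) : StronglyMeasurable fun a => A.gain i (P a) := by
  have h1 : StronglyMeasurable fun a => P a * (A.H i).transpose :=
    stronglyMeasurable_bilin (mulBilin m m (d i)) hP stronglyMeasurable_const
  have h2 : StronglyMeasurable fun a => A.H i * P a :=
    stronglyMeasurable_bilin (mulBilin (d i) m m) stronglyMeasurable_const hP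
  have h3 : StronglyMeasurable fun a => A.H i * P a * (A.H i).transpose :=
    stronglyMeasurable_bilin (mulBilin (d i) m (d i)) h2 stronglyMeasurable_const
  exact stronglyMeasurable_bilin (mulBilin m (d i) (d i)) h1
    (stronglyMeasurable_matrix_inv (h3.add stronglyMeasurable_const))

lemma measurable_update (i : ℕ) {P : α → Matrix (Fin m) (Fin m) ℝ} (hP : StronglyMeasurable P)
    {x : α → EuclideanSpace ℝ (Fin m)} (hx : Measurable x)
    {w : α → EuclideanSpace ℝ (Fin (d i))} (hw : Measurable w) :
    Measurable fun a => A.update i (P a) (x a) (w a) := by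
  have h1 : Measurable fun a => A.y i - w a - Matrix.toEuclideanLin (A.H i) (x a) :=
    (hw.const_sub _).sub
      ((LinearMap.continuous_of_finiteDimensional (Matrix.toEuclideanLin (A.H i))).measurable.comp
        hx)
  exact hx.add (stronglyMeasurable_bilin (actBilin m (d i)) (A.stronglyMeasurable_gain i hP)
    h1.stronglyMeasurable).measurable

lemma stronglyMeasurable_sampleCov {N : ℕ} {x : Fin N → α → EuclideanSpace ℝ (Fin m)}
    (hx : ∀ n, Measurable (x n)) : StronglyMeasurable fun a => sampleCov fun n => x n a := by
  have hmean : Measurable fun a => sampleMean fun n => x n a :=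
    (Finset.measurable_fun_sum _ fun n _ => hx n).const_smul (N : ℝ)⁻¹
  have hn : ∀ n, StronglyMeasurable fun a => x n a - sampleMean fun n => x n a :=
    fun n => ((hx n).sub hmean).stronglyMeasurable
  exact (Finset.stronglyMeasurable_fun_sum _ fun n _ =>
    stronglyMeasurable_bilin (outerBilin m) (hn n) (hn n)).const_smul ((N : ℝ) - 1)⁻¹

lemma measurable_Uwith (P : ℕ → Matrix (Fin m) (Fin m) ℝ) (ξ : EnsembleNoise m d α) (n : ℕ)
    (h₀ : Measurable (ξ.X₀ n)) (hV : ∀ i, Measurable (ξ.V i n)) (hW : ∀ i, Measurable (ξ.W i n))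
    (i : ℕ) : Measurable (A.Uwith P ξ i n) := by
  induction i with
  | zero => exact h₀
  | succ i ih =>
    exact A.measurable_update _ stronglyMeasurable_const (A.measurable_advance _ ih (hV _)) (hW _)

lemma measurable_X (ξ : EnsembleNoise m d α)
    (h₀ : ∀ n, Measurable (ξ.X₀ n)) (hV : ∀ i n, Measurable (ξ.V i n))
    (hW : ∀ i n, Measurable (ξ.W i n)) (N i : ℕ) (n : Fin N) : Measurable (A.X ξ N i n) := by
  induction i generalizing n with
  | zero => exact h₀ n
  | succ i ih =>
    have hf : ∀ n : Fin N, Measurable fun ω => A.advance (i + 1) (A.X ξ N i n ω)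
      (ξ.V (i + 1) n ω) := fun n => A.measurable_advance _ (ih n) (hV _ _)
    exact A.measurable_update _ (stronglyMeasurable_sampleCov hf) (hf n) (hW _ _)

end Measurability

end LinearModel

/-- The σ-algebra is left free: it is taken both as the product σ-algebra and as the one generated
by a single member's noise. -/
lemma measurable_coordNoise {n : ℕ}
    {M : MeasurableSpace ((j : NoiseIndex k) → EuclideanSpace ℝ (Fin (j.dim m d)))}
    (hM : ∀ j : NoiseIndex k, j.member = n → Measurable[M]
      (fun z : (j : NoiseIndex k) → EuclideanSpace ℝ (Fin (j.dim m d)) => z j)) :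
    Measurable[M] ((coordNoise m d k).X₀ n) ∧ (∀ i, Measurable[M] ((coordNoise m d k).V i n)) ∧
      ∀ i, Measurable[M] ((coordNoise m d k).W i n) := by
  refine ⟨hM (.init n) rfl, fun i => ?_, fun i => ?_⟩
  · cases i with
    | zero => exact measurable_const
    | succ i =>
      by_cases h : i < k
      · rw [show (coordNoise m d k).V (i + 1) n = fun z => z (.model ⟨i, h⟩ n) from
          funext fun z => dif_pos h]
        exact hM (.model ⟨i, h⟩ n) rfl
      · simp [coordNoise, h]
  · cases i with
    | zero => exact measurable_const
    | succ i =>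
      by_cases h : i < k
      · rw [show (coordNoise m d k).W (i + 1) n = fun z => z (.data ⟨i, h⟩ n) from
          funext fun z => dif_pos h]
        exact hM (.data ⟨i, h⟩ n) rfl
      · simp [coordNoise, h]

lemma measurable_coordNoise_pi (n : ℕ) :
    Measurable ((coordNoise m d k).X₀ n) ∧ (∀ i, Measurable ((coordNoise m d k).V i n)) ∧
      ∀ i, Measurable ((coordNoise m d k).W i n) :=
  measurable_coordNoise fun j _ => measurable_pi_apply j

variable [MeasurableSpace Ω] {μ : Measure Ω}

lemma exists_injective_extend {N : ℕ} (π : Equiv.Perm (Fin N)) :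
    ∃ σ : ℕ → ℕ, Function.Injective σ ∧ ∀ n : Fin N, σ n = π n :=
  ⟨π.extendDomain Fin.equivSubtype, Equiv.injective _, fun n =>
    π.extendDomain_apply_image Fin.equivSubtype n⟩

/-- Members that are functions of the noise, equivariantly under permutations of the labels, have
an exchangeable joint law. -/
lemma IIDNoise.identDistrib_perm {ξ : EnsembleNoise m d Ω} (h : IIDNoise μ ξ k) {S : Type*}
    [MeasurableSpace S] {N : ℕ} {F : Fin N → Ω → S}
    {Φ : Fin N → ((j : NoiseIndex k) → EuclideanSpace ℝ (Fin (j.dim m d))) → S}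
    (hΦ : ∀ n, Measurable (Φ n))
    (hF : ∀ (π : Equiv.Perm (Fin N)) (ω : Ω)
      (z : (j : NoiseIndex k) → EuclideanSpace ℝ (Fin (j.dim m d))),
      (∀ n : Fin N, MemberAgree k ξ (coordNoise m d k) ω z (π n) n) →
        ∀ n, F (π n) ω = Φ n z) (π : Equiv.Perm (Fin N)) :
    IdentDistrib (fun ω n => F (π n) ω) (fun ω n => F n ω) μ μ := by
  obtain ⟨σ, hσ, hσπ⟩ := exists_injective_extend π
  have h1 : (fun ω n => F (π n) ω) = (fun z n => Φ n z) ∘ (ξ.relabel σ).path k := by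
    ext1 ω; ext1 n
    refine hF π ω _ (fun n => ?_) n
    rw [← hσπ]
    exact memberAgree_relabel_path ξ σ ω n
  have h2 : (fun ω n => F n ω) = (fun z n => Φ n z) ∘ ξ.path k := by
    ext1 ω; ext1 n
    exact hF 1 ω _ (fun n => memberAgree_path ξ ω n) n
  rw [h1, h2]
  exact (h.identDistrib_path hσ).comp (measurable_pi_lambda _ hΦ)

lemma IIDNoise.identDistrib_member {ξ : EnsembleNoise m d Ω} (h : IIDNoise μ ξ k) {S : Type*}
    [MeasurableSpace S] {N : ℕ} {F : Fin N → Ω → S}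
    {Φ : Fin N → ((j : NoiseIndex k) → EuclideanSpace ℝ (Fin (j.dim m d))) → S}
    (hΦ : ∀ n, Measurable (Φ n))
    (hF : ∀ (π : Equiv.Perm (Fin N)) (ω : Ω)
      (z : (j : NoiseIndex k) → EuclideanSpace ℝ (Fin (j.dim m d))),
      (∀ n : Fin N, MemberAgree k ξ (coordNoise m d k) ω z (π n) n) →
        ∀ n, F (π n) ω = Φ n z) (n n' : Fin N) :
    IdentDistrib (F n) (F n') μ μ := by
  -- The swap sends n' to n; projecting the permuted family to coordinate n' leaves `F n`.
  simpa [Function.comp_def] using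
    (h.identDistrib_perm hΦ hF (Equiv.swap n' n)).comp (measurable_pi_apply n')

variable (A : LinearModel m d) {ξ : EnsembleNoise m d Ω} {i : ℕ}

lemma pair_congr (μ : Measure Ω) (hi : i ≤ k) {N : ℕ} (π : Equiv.Perm (Fin N)) (ω : Ω)
    (z : (j : NoiseIndex k) → EuclideanSpace ℝ (Fin (j.dim m d)))
    (h : ∀ n : Fin N, MemberAgree k ξ (coordNoise m d k) ω z (π n) n) (n : Fin N) :
    (A.X ξ N i (π n) ω, A.U ξ μ i (π n) ω) = (A.X (coordNoise m d k) N i n z,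
      A.Uwith (fun i => covMatrix μ (A.Uforecast ξ μ i 0)) (coordNoise m d k) i n z) := by
  rw [A.X_congr h hi, A.U_eq_Uwith, A.Uwith_congr _ (h n) hi]

lemma measurable_pair (P : ℕ → Matrix (Fin m) (Fin m) ℝ) {N : ℕ} (n : Fin N) :
    Measurable fun z => (A.X (coordNoise m d k) N i n z, A.Uwith P (coordNoise m d k) i n z) :=
  (A.measurable_X _ (fun n => (measurable_coordNoise_pi n).1)
    (fun i n => (measurable_coordNoise_pi n).2.1 i)
    (fun i n => (measurable_coordNoise_pi n).2.2 i) _ _ _).prodMk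
  (A.measurable_Uwith _ _ _ (measurable_coordNoise_pi _).1 (measurable_coordNoise_pi _).2.1
    (measurable_coordNoise_pi _).2.2 _)

lemma IIDNoise.exchangeable (h : IIDNoise μ ξ k) (hi : i ≤ k) (N : ℕ) :
    Exchangeable μ (fun (n : Fin N) (ω : Ω) => (A.X ξ N i n ω, A.U ξ μ i n ω)) := fun π _ hB =>
  (h.identDistrib_perm (F := fun n ω => (A.X ξ N i n ω, A.U ξ μ i n ω))
    (fun n => measurable_pair A _ n) (pair_congr A μ hi) π).measure_mem_eq hB

lemma IIDNoise.identDistrib_pair (h : IIDNoise μ ξ k) (hi : i ≤ k) {N : ℕ} (n n' : Fin N) :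
    IdentDistrib (fun ω => (A.X ξ N i n ω, A.U ξ μ i n ω))
      (fun ω => (A.X ξ N i n' ω, A.U ξ μ i n' ω)) μ μ :=
  h.identDistrib_member (F := fun n ω => (A.X ξ N i n ω, A.U ξ μ i n ω))
    (fun n => measurable_pair A _ n) (pair_congr A μ hi) n n'

lemma IIDNoise.identDistrib_forecast (h : IIDNoise μ ξ k) (hi : i < k) {N : ℕ} (n n' : Fin N) :
    IdentDistrib (fun ω => (A.Xforecast ξ N (i + 1) n ω, A.Uforecast ξ μ (i + 1) n ω))
      (fun ω => (A.Xforecast ξ N (i + 1) n' ω, A.Uforecast ξ μ (i + 1) n' ω)) μ μ := by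
  refine h.identDistrib_member
    (F := fun n ω => (A.Xforecast ξ N (i + 1) n ω, A.Uforecast ξ μ (i + 1) n ω))
    (Φ := fun n z => (A.Xforecast (coordNoise m d k) N (i + 1) n z, A.advance (i + 1)
      (A.Uwith (fun i => covMatrix μ (A.Uforecast ξ μ i 0)) (coordNoise m d k) i n z)
      ((coordNoise m d k).V (i + 1) n z))) (fun n => ?_) (fun π ω z hz n => ?_) n n'
  · have := measurable_pair (k := k) (i := i) A
      (fun i => covMatrix μ (A.Uforecast ξ μ i 0)) n
    exact (A.measurable_advance _ this.fst ((measurable_coordNoise_pi _).2.1 _)).prodMk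
      (A.measurable_advance _ this.snd ((measurable_coordNoise_pi _).2.1 _))
  · rw [A.Xforecast_congr hz hi, LinearModel.Uforecast, Nat.add_sub_cancel, A.U_eq_Uwith,
      A.Uwith_congr _ (hz n) hi.le, (hz n).model i hi]

/-- Reference member n reads the noise of member n only; this is the source of independence. -/
lemma measurable_Uwith_coordNoise (P : ℕ → Matrix (Fin m) (Fin m) ℝ) (n : ℕ) :
    (Measurable[⨆ j ∈ {j : NoiseIndex k | j.member = n}, MeasurableSpace.comap
      (fun z : (j : NoiseIndex k) → EuclideanSpace ℝ (Fin (j.dim m d)) => z j) inferInstance]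
      (A.Uwith P (coordNoise m d k) i n)) ∧
    ∀ i, Measurable[⨆ j ∈ {j : NoiseIndex k | j.member = n}, MeasurableSpace.comap
      (fun z : (j : NoiseIndex k) → EuclideanSpace ℝ (Fin (j.dim m d)) => z j) inferInstance]
      ((coordNoise m d k).V i n) := by
  obtain ⟨h₀, hV, hW⟩ := measurable_coordNoise (m := m) (d := d) (k := k) (n := n)
    (M := ⨆ j ∈ {j : NoiseIndex k | j.member = n}, MeasurableSpace.comap
      (fun z : (j : NoiseIndex k) → EuclideanSpace ℝ (Fin (j.dim m d)) => z j) inferInstance)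
    fun j hj => (comap_measurable _).mono (le_iSup₂_of_le j hj le_rfl) le_rfl
  exact ⟨@LinearModel.measurable_Uwith _ _ A _ (_) P (coordNoise m d k) n h₀ hV hW i, hV⟩

variable [IsProbabilityMeasure μ]

lemma IIDNoise.indepFun_U (h : IIDNoise μ ξ k) (hi : i ≤ k) :
    Pairwise fun a b => IndepFun (A.U ξ μ i a) (A.U ξ μ i b) μ := by
  intro a b hab
  have e : ∀ n, A.U ξ μ i n = fun ω =>
      A.Uwith (fun i => covMatrix μ (A.Uforecast ξ μ i 0)) (coordNoise m d k) i n (ξ.path k ω) :=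
    fun n => by ext1 ω; rw [A.U_eq_Uwith, A.Uwith_congr _ (memberAgree_path ξ ω n) hi]
  rw [e, e]
  exact h.indepFun_of_member hab (measurable_Uwith_coordNoise A _ a).1
    (measurable_Uwith_coordNoise A _ b).1

lemma IIDNoise.indepFun_Uforecast (h : IIDNoise μ ξ k) (hi : i < k) :
    Pairwise fun a b => IndepFun (A.Uforecast ξ μ (i + 1) a) (A.Uforecast ξ μ (i + 1) b) μ := by
  intro a b hab
  have e : ∀ n, A.Uforecast ξ μ (i + 1) n = fun ω => (fun z => A.advance (i + 1)
      (A.Uwith (fun i => covMatrix μ (A.Uforecast ξ μ i 0)) (coordNoise m d k) i n z)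
      ((coordNoise m d k).V (i + 1) n z)) (ξ.path k ω) := fun n => by
    ext1 ω
    rw [LinearModel.Uforecast, Nat.add_sub_cancel, A.U_eq_Uwith,
      A.Uwith_congr _ (memberAgree_path ξ ω n) hi.le, (memberAgree_path ξ ω n).model i hi]
  have hm := fun n => measurable_Uwith_coordNoise (k := k) (i := i) A
    (fun i => covMatrix μ (A.Uforecast ξ μ i 0)) n
  rw [e, e]
  exact h.indepFun_of_member hab
    (@LinearModel.measurable_advance _ _ A _ (_) (i + 1) _ _ (hm a).1 ((hm a).2 _))
    (@LinearModel.measurable_advance _ _ A _ (_) (i + 1) _ _ (hm b).1 ((hm b).2 _))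

end Processes

/-! ### Convergence of sample moments, gain and members. -/

section Convergence

variable {Ω : Type*} [MeasurableSpace Ω] {μ : Measure Ω} [IsProbabilityMeasure μ]

lemma ConvergesInAllLp.mean_bilin {F H : Type*} [NormedAddCommGroup F] [NormedSpace ℝ F]
    [FiniteDimensional ℝ F] [MeasurableSpace F] [BorelSpace F] [NormedAddCommGroup H]
    [NormedSpace ℝ H] [FiniteDimensional ℝ H] (B : F →ₗ[ℝ] F →ₗ[ℝ] H)
    {Z : (N : ℕ) → Fin (N + 1) → Ω → F} {W : ℕ → Ω → F}
    (h : ConvergesInAllLp μ (fun N => Z N 0) (W 0))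
    (hid : ∀ N (n : Fin (N + 1)),
      IdentDistrib (fun ω => (Z N n ω, W n ω)) (fun ω => (Z N 0 ω, W 0 ω)) μ μ)
    (hind : Pairwise fun i j => IndepFun (W i) (W j) μ) :
    ConvergesInAllLp μ (fun N ω => ((N + 1 : ℕ) : ℝ)⁻¹ • ∑ n, B (Z N n ω) (Z N n ω))
      (fun _ => ∫ ω, B (W 0 ω) (W 0 ω) ∂μ) := by
  intro p hp hp'
  let _ : MeasurableSpace H := borel H
  have : BorelSpace H := ⟨rfl⟩
  have : CompleteSpace H := FiniteDimensional.complete ℝ H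
  have : ProperSpace H := FiniteDimensional.proper ℝ H
  have : ProperSpace F := FiniteDimensional.proper ℝ F
  have hB : Measurable fun x : F => B x x :=
    (B.toContinuousBilinearMap.continuous₂.comp (continuous_id.prodMk continuous_id)).measurable
  exact ConvergesInLp.mean (Z := fun N n ω => B (Z N n ω) (Z N n ω))
    (W := fun n ω => B (W n ω) (W n ω)) hp hp' (h.bilin B h p hp hp')
    (fun N n => (hid N n).comp (u := fun z : F × F => (B z.1 z.1, B z.2 z.2))
      ((hB.comp measurable_fst).prodMk (hB.comp measurable_snd)))
    fun i j hij => (hind hij).comp hB hB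

variable {m : ℕ}

lemma ConvergesInAllLp.sampleMean {Z : (N : ℕ) → Fin (N + 1) → Ω → EuclideanSpace ℝ (Fin m)}
    {W : ℕ → Ω → EuclideanSpace ℝ (Fin m)}
    (h : ConvergesInAllLp μ (fun N => Z N 0) (W 0))
    (hid : ∀ N (n : Fin (N + 1)),
      IdentDistrib (fun ω => (Z N n ω, W n ω)) (fun ω => (Z N 0 ω, W 0 ω)) μ μ)
    (hind : Pairwise fun i j => IndepFun (W i) (W j) μ) :
    ConvergesInAllLp μ (fun N ω => EnKF.sampleMean fun n => Z N n ω)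
      (fun _ => ∫ ω, W 0 ω ∂μ) :=
  fun p hp hp' => (h p hp hp').mean hp hp' hid hind

lemma ConvergesInAllLp.sampleCov {Z : (N : ℕ) → Fin (N + 1) → Ω → EuclideanSpace ℝ (Fin m)}
    {W : ℕ → Ω → EuclideanSpace ℝ (Fin m)}
    (h : ConvergesInAllLp μ (fun N => Z N 0) (W 0))
    (hid : ∀ N (n : Fin (N + 1)),
      IdentDistrib (fun ω => (Z N n ω, W n ω)) (fun ω => (Z N 0 ω, W 0 ω)) μ μ)
    (hind : Pairwise fun i j => IndepFun (W i) (W j) μ) :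
    ConvergesInAllLp μ (fun N ω => EnKF.sampleCov fun n => Z N n ω)
      (fun _ => covMatrix μ (W 0)) := by
  have hmean := h.sampleMean hid hind
  have hc : Tendsto (fun N : ℕ => ((N + 1 : ℕ) : ℝ) / N) atTop (𝓝 1) := by
    have h1 : Tendsto (fun N : ℕ => 1 + (1 : ℝ) / N) atTop (𝓝 (1 + 0)) :=
      tendsto_const_nhds.add (tendsto_const_div_atTop_nhds_zero_nat 1)
    rw [add_zero] at h1
    -- The quotient equals 1 + 1/N only for N > 0, hence the eventual equality.
    refine h1.congr' ?_
    filter_upwards [eventually_gt_atTop 0] with N hN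
    have : (N : ℝ) ≠ 0 := by positivity
    push_cast
    field_simp
  have h2 := ((h.mean_bilin (outerBilin m) hid hind).add
    ((hmean.bilin (outerBilin m) hmean).linear (-LinearMap.id))).smul_const_seq hc
  have hW : MemLp (W 0) 2 μ := (h 2 (by norm_num) (by norm_num)).2.1
  simp only [sampleCov_eq, covMatrix_eq hW]
  simpa only [LinearMap.neg_apply, LinearMap.id_apply, ← sub_eq_add_neg, one_smul] using h2

variable {d : ℕ → ℕ} (A : LinearModel m d)

lemma ConvergesInAllLp.gain {i : ℕ} (hR : (A.R i).PosDef)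
    {P : ℕ → Ω → Matrix (Fin m) (Fin m) ℝ} {P' : Matrix (Fin m) (Fin m) ℝ}
    (h : ConvergesInAllLp μ P (fun _ => P')) (hP : ∀ N ω, (P N ω).PosSemidef)
    (hP' : P'.PosSemidef) :
    ConvergesInAllLp μ (fun N ω => A.gain i (P N ω)) (fun _ => A.gain i P') := by
  have hconst : ∀ {a b : ℕ} (M : Matrix (Fin a) (Fin b) ℝ),
      ConvergesInAllLp μ (fun _ (_ : Ω) => M) (fun _ => M) := fun M =>
    ConvergesInAllLp.const fun p _ => memLp_const M
  have hS : ConvergesInAllLp μ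
      (fun N ω => A.H i * P N ω * (A.H i).transpose + A.R i)
      (fun _ => A.H i * P' * (A.H i).transpose + A.R i) :=
    (((hconst (A.H i)).bilin (mulBilin (d i) m m) h).bilin (mulBilin (d i) m (d i))
      (hconst (A.H i).transpose)).add (hconst (A.R i))
  obtain ⟨C, hC0, hC⟩ := exists_norm_inv_le hR
  have hpsd : ∀ {T : Matrix (Fin m) (Fin m) ℝ}, T.PosSemidef →
      (A.H i * T * (A.H i).transpose).PosSemidef := fun {T} hT => by
    simpa using hT.mul_mul_conjTranspose_same (A.H i)
  have hunit : ∀ {T : Matrix (Fin m) (Fin m) ℝ}, T.PosSemidef →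
      IsUnit (A.H i * T * (A.H i).transpose + A.R i).det := fun {T} hT =>
    (Matrix.isUnit_iff_isUnit_det _).1 (hR.posSemidef_add (hpsd hT)).isUnit
  have hinv : ConvergesInAllLp μ
      (fun N ω => (A.H i * P N ω * (A.H i).transpose + A.R i)⁻¹)
      (fun _ => (A.H i * P' * (A.H i).transpose + A.R i)⁻¹) := by
    refine hS.of_norm_sub_le (C * C)
      (fun N => aestronglyMeasurable_matrix_inv ((hS 1 le_rfl (by simp)).1 N).1) fun N ω => ?_
    set S := A.H i * P N ω * (A.H i).transpose + A.R i
    set S' := A.H i * P' * (A.H i).transpose + A.R i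
    -- The resolvent identity, with both inverses bounded by C, gives the Lipschitz constant C².
    have e : S⁻¹ - S'⁻¹ = S⁻¹ * (S' - S) * S'⁻¹ := by
      rw [Matrix.mul_sub, Matrix.sub_mul, Matrix.nonsing_inv_mul _ (hunit (hP N ω)),
        Matrix.mul_assoc, Matrix.mul_nonsing_inv _ (hunit hP'), Matrix.mul_one, Matrix.one_mul]
    rw [e]
    calc ‖S⁻¹ * (S' - S) * S'⁻¹‖ ≤ ‖S⁻¹‖ * ‖S' - S‖ * ‖S'⁻¹‖ :=
          (Matrix.l2_opNorm_mul _ _).trans (by gcongr; exact Matrix.l2_opNorm_mul _ _)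
      _ ≤ C * ‖S' - S‖ * C := by
          gcongr
          · exact hC _ (hpsd (hP N ω))
          · exact hC _ (hpsd hP')
      _ = C * C * ‖S - S'‖ := by rw [norm_sub_rev]; ring
  exact (h.bilin (mulBilin m m (d i)) (hconst (A.H i).transpose)).bilin
    (mulBilin m (d i) (d i)) hinv

variable {k : ℕ} {ξ : EnsembleNoise m d Ω}

lemma convergesInAllLp_Xforecast {i : ℕ}
    (hV : ∀ p : ℝ≥0∞, p ≠ ⊤ → MemLp (ξ.V (i + 1) 0) p μ)
    (h : ConvergesInAllLp μ (fun N => A.X ξ (N + 1) i 0) (A.U ξ μ i 0)) :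
    ConvergesInAllLp μ (fun N => A.Xforecast ξ (N + 1) (i + 1) 0) (A.Uforecast ξ μ (i + 1) 0) :=
  ((h.linear (Matrix.toEuclideanLin (A.M (i + 1)))).add
    (ConvergesInAllLp.const fun _ _ => memLp_const (A.drift (i + 1)))).add
    (ConvergesInAllLp.const hV)

lemma IIDNoise.convergesInAllLp_sampleCov (hξ : IIDNoise μ ξ k) {i : ℕ} (hi : i < k)
    (hV : ∀ p : ℝ≥0∞, p ≠ ⊤ → MemLp (ξ.V (i + 1) 0) p μ)
    (h : ConvergesInAllLp μ (fun N => A.X ξ (N + 1) i 0) (A.U ξ μ i 0)) :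
    ConvergesInAllLp μ
      (fun N ω => EnKF.sampleCov fun n : Fin (N + 1) => A.Xforecast ξ (N + 1) (i + 1) n ω)
      (fun _ => covMatrix μ (A.Uforecast ξ μ (i + 1) 0)) :=
  (convergesInAllLp_Xforecast A hV h).sampleCov
    (Z := fun N n => A.Xforecast ξ (N + 1) (i + 1) n) (W := A.Uforecast ξ μ (i + 1))
    (fun _ n => hξ.identDistrib_forecast A hi n 0) (hξ.indepFun_Uforecast A hi)

/-- The first ensemble member converges to the first reference member. -/
lemma IIDNoise.convergesInAllLp_X (hξ : IIDNoise μ ξ k)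
    (hR : ∀ i < k, (A.R (i + 1)).PosDef)
    (h₀ : ∀ p : ℝ≥0∞, p ≠ ⊤ → MemLp (ξ.X₀ 0) p μ)
    (hV : ∀ i < k, ∀ p : ℝ≥0∞, p ≠ ⊤ → MemLp (ξ.V (i + 1) 0) p μ)
    (hW : ∀ i < k, ∀ p : ℝ≥0∞, p ≠ ⊤ → MemLp (ξ.W (i + 1) 0) p μ) {i : ℕ} (hi : i ≤ k) :
    ConvergesInAllLp μ (fun N => A.X ξ (N + 1) i 0) (A.U ξ μ i 0) := by
  induction i with
  | zero => exact ConvergesInAllLp.const h₀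
  | succ i ih =>
    have hX := ih (by lia)
    have hf := convergesInAllLp_Xforecast A (hV i hi) hX
    have hP := hξ.convergesInAllLp_sampleCov A hi (hV i hi) hX
    have hgain := hP.gain A (hR i hi) (fun N ω => sampleCov_posSemidef _)
      (covMatrix_posSemidef (hf 2 (by norm_num) (by norm_num)).2.1)
    have hWneg : ∀ p : ℝ≥0∞, p ≠ ⊤ → MemLp (fun ω => A.y (i + 1) - ξ.W (i + 1) 0 ω) p μ :=
      fun p hp => (memLp_const _).sub (hW i hi p hp)
    -- The innovation y - W - H X: the perturbation W is shared by both ensembles, so only the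
    -- forecast varies with N.
    have hinn := (ConvergesInAllLp.const hWneg).add
      (hf.linear (-(Matrix.toEuclideanLin (A.H (i + 1)))))
    have := hf.add (hgain.bilin (actBilin m (d (i + 1))) hinn)
    simp only [LinearMap.neg_apply, ← sub_eq_add_neg] at this
    exact this

end Convergence

/-! ### Gaussian moments and the theorem. -/

lemma memLp_of_hasLaw_multivariateGaussian {Ω : Type*} [MeasurableSpace Ω] {μ : Measure Ω} {n : ℕ}
    {X : Ω → EuclideanSpace ℝ (Fin n)} {x : EuclideanSpace ℝ (Fin n)}
    {S : Matrix (Fin n) (Fin n) ℝ} (hX : HasLaw X (multivariateGaussian x S) μ) (p : ℝ≥0∞)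
    (hp : p ≠ ⊤) : MemLp X p μ := by
  have h := IsGaussian.memLp_id (multivariateGaussian x S) p hp
  rw [← hX.map_eq] at h
  exact (memLp_map_measure_iff h.1 hX.aemeasurable).1 h

end EnKF

end

theorem mainTheorem6 {Ω : Type*} [MeasurableSpace Ω] (μ : Measure Ω) [IsProbabilityMeasure μ]
    (m : ℕ) (d : ℕ → ℕ) (k : ℕ) (A : EnKF.LinearModel m d) (ξ : EnKF.EnsembleNoise m d Ω)
    (hB : A.B.PosSemidef)
    (hQ : ∀ i ∈ Finset.Icc 1 k, (A.Q i).PosSemidef)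
    (hR : ∀ i ∈ Finset.Icc 1 k, (A.R i).PosDef)
    (hX₀ : ∀ n, HasLaw (ξ.X₀ n) (multivariateGaussian A.xb A.B) μ)
    (hV : ∀ i ∈ Finset.Icc 1 k, ∀ n, HasLaw (ξ.V i n) (multivariateGaussian 0 (A.Q i)) μ)
    (hW : ∀ i ∈ Finset.Icc 1 k, ∀ n, HasLaw (ξ.W i n) (multivariateGaussian 0 (A.R i)) μ)
    (hind : iIndepFun (ξ.family k) μ) :
    (∀ i ≤ k,
      (∀ N : ℕ, EnKF.Exchangeable μ
        (fun (n : Fin N) (ω : Ω) => (A.X ξ N i n ω, A.U ξ μ i n ω))) ∧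
      (∀ p : ℝ≥0∞, 1 ≤ p → p ≠ ⊤ →
        EnKF.ConvergesInLp μ p (fun N => A.X ξ (N + 1) i 0) (A.U ξ μ i 0) ∧
        EnKF.ConvergesInLp μ p
          (fun N ω => EnKF.sampleMean fun n : Fin (N + 1) => A.X ξ (N + 1) i n ω)
          (fun _ => ∫ ω, A.U ξ μ i 0 ω ∂μ))) ∧
    (∀ i ∈ Finset.Icc 1 k, ∀ p : ℝ≥0∞, 1 ≤ p → p ≠ ⊤ →
      EnKF.ConvergesInLp μ p
        (fun N ω => EnKF.sampleCov fun n : Fin (N + 1) => A.Xforecast ξ (N + 1) i n ω)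
        (fun _ => EnKF.covMatrix μ (A.Uforecast ξ μ i 0))) := by
  have hIcc : ∀ i < k, i + 1 ∈ Finset.Icc 1 k := fun i hi => Finset.mem_Icc.2 ⟨by lia, hi⟩
  have hξ : EnKF.IIDNoise μ ξ k :=
    { aemeasurable := fun j => by
        cases j with
        | init n => exact (hX₀ n).aemeasurable
        | model i n => exact (hV _ (hIcc i i.2) n).aemeasurable
        | data i n => exact (hW _ (hIcc i i.2) n).aemeasurable
      map_init := fun n n' => (hX₀ n).map_eq.trans (hX₀ n').map_eq.symm
      map_model := fun i hi n n' =>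
        (hV _ (hIcc i hi) n).map_eq.trans (hV _ (hIcc i hi) n').map_eq.symm
      map_data := fun i hi n n' =>
        (hW _ (hIcc i hi) n).map_eq.trans (hW _ (hIcc i hi) n').map_eq.symm
      indep := hind }
  have hVp := fun i (hi : i < k) => EnKF.memLp_of_hasLaw_multivariateGaussian (hV _ (hIcc i hi) 0)
  have hconv : ∀ i ≤ k,
      EnKF.ConvergesInAllLp μ (fun N => A.X ξ (N + 1) i 0) (A.U ξ μ i 0) := fun i hi =>
    hξ.convergesInAllLp_X A (fun i hi => hR _ (hIcc i hi))
      (EnKF.memLp_of_hasLaw_multivariateGaussian (hX₀ 0)) hVp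
      (fun i hi => EnKF.memLp_of_hasLaw_multivariateGaussian (hW _ (hIcc i hi) 0)) hi
  refine ⟨fun i hi => ⟨hξ.exchangeable A hi, fun p hp hp' => ⟨hconv i hi p hp hp', ?_⟩⟩,
    fun i hi p hp hp' => ?_⟩
  · exact (hconv i hi).sampleMean (Z := fun N n => A.X ξ (N + 1) i n)
      (fun _ n => hξ.identDistrib_pair A hi n 0) (hξ.indepFun_U A hi) p hp hp'
  · obtain ⟨h1, h2⟩ := Finset.mem_Icc.1 hi
    obtain ⟨i, rfl⟩ : ∃ l, i = l + 1 := ⟨i - 1, by lia⟩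
    exact hξ.convergesInAllLp_sampleCov A h2 (hVp i h2) (hconv i (by lia)) p hp hp'
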